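/- Let $p$ be an odd prime and $m\ge 1$ such that $2$ is a primitive root modulo $p^m$, i.e. the class of $2$ generates $(\mathbb{Z}/p^m\mathbb{Z})^\times$. For a binary linear code $C\subseteq\mathbb{F}_2^n$ let $C^2$ be the linear span of all coordinatewise (Schur) products $c\circ c'$ with $c,c'\in C$. Let $L\ge 2$ and let $C_1,\dots,C_L\subseteq\mathbb{F}_2^{p^m}$ be binary cyclic linear codes with $C_{k+1}=C_k^2$ for $1\le k\le L-1$. Then the chain stabilizes at the second level: $C_1^2=C_2=C_2^2$, and hence $C_k=C_2=C_k^2$ for all $2\le k\le L$. (Here a chain is said to stabilize at level $t+1$ if $t\ge 1$ is the smallest index with $t+1\le L$ and $C_t^2=C_{t+1}=C_{t+1}^2$.) -/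

import Mathlib

/-- A binary linear code of length `n`: a linear subspace of `(ℤ/2)^n`. -/
abbrev BinaryLinearCode (n : ℕ) : Type := Submodule (ZMod 2) (Fin n → ZMod 2)

/-- The cyclic shift `(c₁, …, cₙ) ↦ (cₙ, c₁, …, cₙ₋₁)`; `finRotate n` is `i ↦ i + 1` modulo `n`. -/
def cyclicShift {n : ℕ} (c : Fin n → ZMod 2) : Fin n → ZMod 2 :=
  fun i => c ((finRotate n).symm i)

/-- A code is cyclic if it contains the cyclic shift of each of its codewords. -/
def IsCyclicCode {n : ℕ} (C : BinaryLinearCode n) : Prop :=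
  ∀ c ∈ C, cyclicShift c ∈ C

/-- The Schur (coordinatewise) product of two words. -/
def schurProduct {n : ℕ} (x y : Fin n → ZMod 2) : Fin n → ZMod 2 :=
  fun i => x i * y i

/-- The square `C²` of a code: the subspace generated by all Schur products of two codewords. -/
def schurSquare {n : ℕ} (C : BinaryLinearCode n) : BinaryLinearCode n :=
  Submodule.span (ZMod 2) {z | ∃ x ∈ C, ∃ y ∈ C, z = schurProduct x y}

/-- The codes `C 1, …, C L` form a chain of squares of cyclic codes: each of them is cyclic and
each one after the first is the square of its predecessor. Values of `C` outside `1, …, L` play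
no role. -/
structure IsCyclicSquareChain {n : ℕ} (C : ℕ → BinaryLinearCode n) (L : ℕ) : Prop where
  cyclic : ∀ k, 1 ≤ k → k ≤ L → IsCyclicCode (C k)
  succ_eq_square : ∀ k, 1 ≤ k → k + 1 ≤ L → C (k + 1) = schurSquare (C k)

/-- The chain `C 1, …, C L` stabilizes at level `t + 1`, where `t` is the smallest index with
`(C t)² = C (t + 1) = (C (t + 1))²`. -/
def StabilizesAtLevel {n : ℕ} (C : ℕ → BinaryLinearCode n) (L s : ℕ) : Prop :=
  ∃ t, s = t + 1 ∧
    IsLeast {t : ℕ | 1 ≤ t ∧ t + 1 ≤ L ∧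
      schurSquare (C t) = C (t + 1) ∧ C (t + 1) = schurSquare (C (t + 1))} t

/-- `g` is a primitive root modulo `n`: it is coprime to `n` and its multiplicative order modulo
`n` is `φ(n)`. -/
def IsPrimitiveRootModulo (g n : ℕ) : Prop :=
  Nat.Coprime g n ∧ orderOf (g : ZMod n) = Nat.totient n

/-!
For every binary cyclic code `C` of length `p ^ m` the square `C²` is closed under Schur products
(`schurSquare_schurSquare`), which gives the theorem at once.

Let `q = p ^ r` be the least power of `p` such that all codewords of `C` are `q`-periodic. The
`q`-periodic words are the functions on `ZMod q`, pulled back along `i ↦ i mod q`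
(`periodicExtension`); they are closed under Schur products, so `C²` consists of such words. It
turns out that `C²` contains all of them, unless `q = 1`, when the codewords are constant and
`C² = C` is clear.

Let `q = p ^ (r + 1)` and `s = p ^ r`, and consider `C` as a shift-invariant subspace `M` of
`ZMod q → ZMod 2`, that is, a submodule of `𝔽₂[X] / (X ^ q - 1)`, on which `X` acts by the shift.
By minimality of `q` some element of `M` is not killed by `X ^ s - 1`. As `2` is a primitive root
modulo `q` too, the quotient `Φ_q` of `X ^ q - 1` by `X ^ s - 1` is irreducible over `𝔽₂`
(`irreducible_cyclotomic_two`), so the multiples of `X ^ s - 1` form a simple module, and `M`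
contains all of them (`single_sub_single_mem`). In particular, if `e j` is the indicator of `j`,
then `M` contains `e j - e (j - s)` and `e (j + s) - e j`. Since `p` is odd, `j - s`, `j` and
`j + s` are distinct, and the product of these two words is `e j` up to sign. Hence `C²` contains
the extensions of all `e j`, which span the `q`-periodic words.
-/

/-! ### Primitive roots and cyclotomic polynomials -/

theorem orderOf_unit_eq_totient_of_dvd {g d n : ℕ} [NeZero n] (hdn : d ∣ n)
    (h : IsPrimitiveRootModulo g n) (hd : g.Coprime d) :
    orderOf (ZMod.unitOfCoprime g hd) = d.totient := by
  have : NeZero d := ⟨fun h0 => NeZero.ne n (by simpa [h0] using hdn)⟩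
  have hu : orderOf (ZMod.unitOfCoprime g h.1) = Nat.card (ZMod n)ˣ := by
    rw [Nat.card_eq_fintype_card, ZMod.card_units_eq_totient, ← orderOf_units,
      ZMod.coe_unitOfCoprime]
    exact h.2
  have hgen (x) : x ∈ Subgroup.zpowers (ZMod.unitOfCoprime g h.1) :=
    Subgroup.eq_top_of_card_eq _ ((Nat.card_zpowers _).trans hu) ▸ Subgroup.mem_top x
  have hmap : ZMod.unitsMap hdn (ZMod.unitOfCoprime g h.1) = ZMod.unitOfCoprime g hd := by
    ext
    simp [ZMod.unitsMap_def]
  rw [← ZMod.card_units_eq_totient, ← Nat.card_eq_fintype_card]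
  refine orderOf_eq_card_of_forall_mem_zpowers fun x => ?_
  obtain ⟨y, rfl⟩ := ZMod.unitsMap_surjective hdn x
  obtain ⟨k, rfl⟩ := Subgroup.mem_zpowers_iff.1 (hgen y)
  exact Subgroup.mem_zpowers_iff.2 ⟨k, by rw [map_zpow, hmap]⟩

theorem irreducible_cyclotomic_two {d n : ℕ} [NeZero n] (hdn : d ∣ n)
    (h : IsPrimitiveRootModulo 2 n) : Irreducible (Polynomial.cyclotomic d (ZMod 2)) := by
  have hd : Nat.Coprime 2 d := h.1.coprime_dvd_right hdn
  refine ZMod.irreducible_of_dvd_cyclotomic_of_natDegree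
    (Nat.prime_two.coprime_iff_not_dvd.1 hd) dvd_rfl ?_
  rw [Polynomial.natDegree_cyclotomic, orderOf_unit_eq_totient_of_dvd hdn h]

/-! ### Words on `ZMod q` and their periodic extensions -/

/-- The cyclic shift on words indexed by `ZMod q`, as a linear map. -/
def zmodShift (q : ℕ) : Module.End (ZMod 2) (ZMod q → ZMod 2) :=
  LinearMap.funLeft (ZMod 2) (ZMod 2) fun i => i - 1

theorem zmodShift_pow_apply {q : ℕ} (k : ℕ) (c : ZMod q → ZMod 2) (i : ZMod q) :
    (zmodShift q ^ k) c i = c (i - k) := by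
  induction k generalizing i with
  | zero => simp
  | succ k ih =>
    rw [pow_succ', Module.End.mul_apply]
    simp only [zmodShift, LinearMap.funLeft_apply] at ih ⊢
    rw [ih]
    push_cast
    congr 1
    ring

theorem zmodShift_pow_single {q : ℕ} (k : ℕ) (j : ZMod q) :
    (zmodShift q ^ k) (Pi.single j 1) = Pi.single (j + k) 1 := by
  ext i
  simp [zmodShift_pow_apply, Pi.single_apply, sub_eq_iff_eq_add]

/-- The `q`-periodic word of length `n` whose entry at `i` is the entry of the given word at
`i mod q`. If `q ∣ n`, then this is compatible with the cyclic shifts. -/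
def periodicExtension (n q : ℕ) : (ZMod q → ZMod 2) →ₗ[ZMod 2] (Fin n → ZMod 2) :=
  LinearMap.funLeft (ZMod 2) (ZMod 2) fun i : Fin n => ((i : ℕ) : ZMod q)

theorem natCast_finRotate_symm {n q : ℕ} (hqn : q ∣ n) (i : Fin n) :
    (((finRotate n).symm i : ℕ) : ZMod q) = ((i : ℕ) : ZMod q) - 1 := by
  obtain ⟨j, rfl⟩ := (finRotate n).surjective i
  have : NeZero n := j.neZero
  have hval : ((finRotate n j : Fin n) : ℕ) = ((j : ℕ) + 1) % n := by
    rw [finRotate_apply, Fin.val_add, Fin.val_one', Nat.add_mod_mod]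
  have hcast : ((((j : ℕ) + 1) % n : ℕ) : ZMod q) = (((j : ℕ) + 1 : ℕ) : ZMod q) :=
    (ZMod.natCast_eq_natCast_iff _ _ _).2 ((Nat.mod_modEq _ _).of_dvd hqn)
  rw [Equiv.symm_apply_apply, hval, hcast]
  simp

theorem cyclicShift_periodicExtension {n q : ℕ} (hqn : q ∣ n) (c : ZMod q → ZMod 2) :
    cyclicShift (periodicExtension n q c) = periodicExtension n q (zmodShift q c) := by
  ext i
  exact congrArg c (natCast_finRotate_symm hqn i)

theorem schurProduct_periodicExtension {n q : ℕ} (x y : ZMod q → ZMod 2) :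
    schurProduct (periodicExtension n q x) (periodicExtension n q y) =
      periodicExtension n q (x * y) :=
  rfl

theorem periodicExtension_self_surjective (n : ℕ) [NeZero n] :
    Function.Surjective (periodicExtension n n) := by
  intro c
  refine ⟨fun z => c ⟨z.val, z.val_lt⟩, ?_⟩
  ext i
  simp [periodicExtension, ZMod.val_natCast, Nat.mod_eq_of_lt i.isLt]

theorem periodicExtension_mem_range {n q s : ℕ} [NeZero q]
    {c : ZMod q → ZMod 2} (hc : (zmodShift q ^ s) c = c) :
    periodicExtension n q c ∈ (periodicExtension n s).range := by
  have hstep (x : ZMod q) : c (x - s) = c x := by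
    conv_rhs => rw [← hc, zmodShift_pow_apply]
  have hmul (k : ℕ) (x : ZMod q) : c (x + s * k) = c x := by
    induction k with
    | zero => simp
    | succ k ih =>
      rw [← hstep, ← ih]
      push_cast
      congr 1
      ring
  refine ⟨fun j => c (j.val : ℕ), ?_⟩
  ext i
  simp only [periodicExtension, LinearMap.funLeft_apply, ZMod.val_natCast]
  rw [← hmul ((i : ℕ) / s) (((i : ℕ) % s : ℕ) : ZMod q)]
  congr 1
  exact_mod_cast congrArg (Nat.cast : ℕ → ZMod q) (Nat.mod_add_div (i : ℕ) s)

/-! ### Shift-invariant subspaces -/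

theorem aeval_mem_of_invariant {V : Type*} [AddCommGroup V] [Module (ZMod 2) V]
    {T : Module.End (ZMod 2) V} {M : Submodule (ZMod 2) V} (hM : ∀ x ∈ M, T x ∈ M)
    (f : Polynomial (ZMod 2)) {x : V} (hx : x ∈ M) : Polynomial.aeval T f x ∈ M := by
  induction f using Polynomial.induction_on' with
  | add f g hf hg => simpa using M.add_mem hf hg
  | monomial k a =>
    rw [Polynomial.aeval_monomial, Module.End.mul_apply, Module.algebraMap_end_apply]
    refine M.smul_mem a ?_
    induction k with
    | zero => simpa
    | succ k ih =>
      rw [pow_succ', Module.End.mul_apply]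
      exact hM _ ih

/-- The words on `ZMod q` form a cyclic module over the polynomial ring. -/
theorem exists_aeval_zmodShift_single {q : ℕ} [NeZero q] (c : ZMod q → ZMod 2) :
    ∃ f : Polynomial (ZMod 2), Polynomial.aeval (zmodShift q) f (Pi.single 0 1) = c := by
  refine ⟨∑ j : ZMod q, Polynomial.C (c j) * Polynomial.X ^ j.val, ?_⟩
  ext i
  simp [map_sum, zmodShift_pow_single, Module.algebraMap_end_apply, Finset.sum_apply,
    Pi.single_apply]

/-- If `Φ_q` is irreducible over `𝔽₂`, where `q = p ^ (r + 1)`, then a shift-invariant subspace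
contains all multiples of `X ^ (p ^ r) - 1` as soon as one of its words is not
`p ^ r`-periodic. -/
theorem single_sub_single_mem {p r : ℕ} [Fact p.Prime]
    (hirr : Irreducible (Polynomial.cyclotomic (p ^ (r + 1)) (ZMod 2)))
    {M : Submodule (ZMod 2) (ZMod (p ^ (r + 1)) → ZMod 2)}
    (hM : ∀ x ∈ M, zmodShift _ x ∈ M) {c : ZMod (p ^ (r + 1)) → ZMod 2} (hcM : c ∈ M)
    (hc : (zmodShift (p ^ (r + 1)) ^ p ^ r) c ≠ c) (j : ZMod (p ^ (r + 1))) :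
    (Pi.single (j + ((p ^ r : ℕ) : ZMod (p ^ (r + 1)))) 1 - Pi.single j 1 : ZMod (p ^ (r + 1)) → ZMod 2) ∈ M := by
  set T := zmodShift (p ^ (r + 1)) with hT
  set Φ := Polynomial.cyclotomic (p ^ (r + 1)) (ZMod 2) with hΦ
  set D : Polynomial (ZMod 2) := Polynomial.X ^ p ^ r - 1 with hD
  set e : ZMod (p ^ (r + 1)) → ZMod 2 := Pi.single 0 1 with he
  have hDT (x) : Polynomial.aeval T D x = (T ^ p ^ r) x - x := by
    simp [hD]
  have hkill : Polynomial.aeval T (Φ * D) e = 0 := by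
    rw [hΦ, hD, Polynomial.cyclotomic_prime_pow_mul_X_pow_sub_one]
    simp only [map_sub, map_pow, Polynomial.aeval_X, map_one, LinearMap.sub_apply,
      Module.End.one_apply, he, hT, zmodShift_pow_single]
    simp
  obtain ⟨f, hf⟩ := exists_aeval_zmodShift_single c
  have hcop : IsCoprime Φ f := by
    refine hirr.coprime_iff_not_dvd.2 ?_
    rintro ⟨g, rfl⟩
    apply hc
    rw [← sub_eq_zero, ← hDT, ← hf, ← Module.End.mul_apply, ← map_mul,
      show D * (Φ * g) = g * (Φ * D) by ring, map_mul, Module.End.mul_apply, ← he, hkill, map_zero]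
  obtain ⟨a, b, hab⟩ := hcop
  have hmem : Polynomial.aeval T (Polynomial.X ^ j.val * b * D) c ∈ M :=
    aeval_mem_of_invariant hM _ hcM
  have hpoly : Polynomial.X ^ j.val * b * D * f =
      Polynomial.X ^ j.val * D - Polynomial.X ^ j.val * a * (Φ * D) := by
    linear_combination (Polynomial.X ^ j.val * D) * hab
  rw [← hf, ← Module.End.mul_apply, ← map_mul, hpoly, map_sub, LinearMap.sub_apply,
    map_mul _ _ (Φ * D), Module.End.mul_apply _ _ (Pi.single 0 1), ← he, hkill, map_zero, sub_zero,
    map_mul, Module.End.mul_apply, hDT, map_sub, map_pow, Polynomial.aeval_X, he, hT,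
    zmodShift_pow_single, zmodShift_pow_single, zmodShift_pow_single] at hmem
  simpa [add_comm] using hmem

/-! ### Squares of cyclic codes -/

theorem le_schurSquare {n : ℕ} (C : BinaryLinearCode n) : C ≤ schurSquare C := by
  refine fun c hc => Submodule.subset_span ⟨c, hc, c, hc, ?_⟩
  ext i
  have h : ∀ x : ZMod 2, x = x * x := by decide
  exact h (c i)

theorem schurProduct_mem_schurSquare {n : ℕ} {C : BinaryLinearCode n} {x y : Fin n → ZMod 2}
    (hx : x ∈ C) (hy : y ∈ C) : schurProduct x y ∈ schurSquare C :=
  Submodule.subset_span ⟨x, hx, y, hy, rfl⟩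

theorem schurSquare_le_range {n q : ℕ} {C : BinaryLinearCode n}
    (h : C ≤ (periodicExtension n q).range) : schurSquare C ≤ (periodicExtension n q).range := by
  refine Submodule.span_le.2 ?_
  rintro _ ⟨x, hx, y, hy, rfl⟩
  obtain ⟨x, rfl⟩ := h hx
  obtain ⟨y, rfl⟩ := h hy
  exact ⟨x * y, (schurProduct_periodicExtension x y).symm⟩

theorem schurSquare_eq_self_of_le_range_one {n : ℕ} {C : BinaryLinearCode n}
    (h : C ≤ (periodicExtension n 1).range) : schurSquare C = C := by
  refine le_antisymm (Submodule.span_le.2 ?_) (le_schurSquare C)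
  rintro _ ⟨x, hx, y, hy, rfl⟩
  obtain ⟨x, rfl⟩ := h hx
  have : schurProduct (periodicExtension n 1 x) y = x 0 • y := by
    ext i
    simp [schurProduct, periodicExtension, Subsingleton.elim _ (0 : ZMod 1)]
  rw [this]
  exact C.smul_mem _ hy

/-- If the words of a cyclic code are all `p ^ (r + 1)`-periodic but not all `p ^ r`-periodic, then
its square consists of all `p ^ (r + 1)`-periodic words. -/
theorem range_le_schurSquare {p n r : ℕ} [Fact p.Prime] (hodd : Odd p) (hdvd : p ^ (r + 1) ∣ n)
    (hirr : Irreducible (Polynomial.cyclotomic (p ^ (r + 1)) (ZMod 2)))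
    {C : BinaryLinearCode n} (hC : IsCyclicCode C)
    (hle : C ≤ (periodicExtension n (p ^ (r + 1))).range)
    (hnle : ¬ C ≤ (periodicExtension n (p ^ r)).range) :
    (periodicExtension n (p ^ (r + 1))).range ≤ schurSquare C := by
  have hp : p.Prime := Fact.out
  set P := periodicExtension n (p ^ (r + 1))
  have hM : ∀ x ∈ C.comap P, zmodShift _ x ∈ C.comap P := fun x hx => by
    rw [Submodule.mem_comap, ← cyclicShift_periodicExtension hdvd]
    exact hC _ hx
  obtain ⟨w, hw, hwn⟩ := Set.not_subset.1 hnle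
  obtain ⟨c, rfl⟩ := hle hw
  have hc : (zmodShift (p ^ (r + 1)) ^ p ^ r) c ≠ c := fun h =>
    hwn (periodicExtension_mem_range h)
  have hdiff := single_sub_single_mem hirr hM hw hc
  set s : ZMod (p ^ (r + 1)) := ((p ^ r : ℕ) : ZMod (p ^ (r + 1))) with hs
  have hpos : 0 < p ^ r := pow_pos hp.pos r
  have h3 : 3 ≤ p := by
    have := hp.two_le
    obtain ⟨k, rfl⟩ := hodd
    omega
  have hs0 : s ≠ 0 := by
    rw [hs, Ne, ZMod.natCast_eq_zero_iff, pow_succ]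
    exact fun h => absurd (Nat.le_of_dvd hpos h) (by nlinarith)
  have hs2 : s + s ≠ 0 := by
    rw [hs, ← Nat.cast_add, Ne, ZMod.natCast_eq_zero_iff, pow_succ]
    exact fun h => absurd (Nat.le_of_dvd (by omega) h) (by nlinarith)
  have hsingle (j) : P (Pi.single j 1) ∈ schurSquare C := by
    have h1 := hdiff (j - s)
    rw [sub_add_cancel] at h1
    have hmem := schurProduct_mem_schurSquare h1 (hdiff j)
    rw [schurProduct_periodicExtension] at hmem
    convert (schurSquare C).neg_mem hmem using 1
    rw [← map_neg]
    congr 1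
    ext i
    -- The supports `{j - s, j}` and `{j, j + s}` of the two factors meet in `j` only.
    have hj1 : j ≠ j + s := by simpa using hs0
    have hj2 : j ≠ j - s := fun h => hs0 (by linear_combination h)
    have hj3 : j + s ≠ j - s := fun h => hs2 (by linear_combination h)
    by_cases hi1 : i = j
    · subst hi1
      simp [hj1, hj2]
    · by_cases hi2 : i = j + s
      · subst hi2
        simp [hj1.symm, hj3]
      · simp [Pi.single_apply, hi1, hi2]
  rintro _ ⟨f, rfl⟩
  rw [← Finset.univ_sum_single f, map_sum]
  refine Submodule.sum_mem _ fun j _ => ?_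
  rw [show Pi.single j (f j) = f j • (Pi.single j 1 : ZMod (p ^ (r + 1)) → ZMod 2) by
    rw [← Pi.single_smul, smul_eq_mul, mul_one], map_smul]
  exact (schurSquare C).smul_mem _ (hsingle j)

theorem schurSquare_schurSquare {p m : ℕ} (hp : p.Prime) (hodd : Odd p)
    (hroot : IsPrimitiveRootModulo 2 (p ^ m)) {C : BinaryLinearCode (p ^ m)}
    (hC : IsCyclicCode C) : schurSquare (schurSquare C) = schurSquare C := by
  classical
  have : Fact p.Prime := ⟨hp⟩
  have hex : ∃ r, r ≤ m ∧ C ≤ (periodicExtension (p ^ m) (p ^ r)).range :=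
    ⟨m, le_rfl, by
      rw [LinearMap.range_eq_top.2 (periodicExtension_self_surjective (p ^ m))]; exact le_top⟩
  obtain ⟨hrm, hle⟩ := Nat.find_spec hex
  have hmin (k : ℕ) := Nat.find_min (H := hex) (m := k)
  generalize Nat.find hex = r at hrm hle hmin
  cases r with
  | zero =>
    rw [pow_zero] at hle
    rw [schurSquare_eq_self_of_le_range_one hle, schurSquare_eq_self_of_le_range_one hle]
  | succ r =>
    have hdvd : p ^ (r + 1) ∣ p ^ m := pow_dvd_pow p hrm
    have hnle : ¬ C ≤ (periodicExtension (p ^ m) (p ^ r)).range := fun h =>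
      hmin r r.lt_succ_self ⟨by omega, h⟩
    refine le_antisymm ?_ (le_schurSquare _)
    exact (schurSquare_le_range (schurSquare_le_range hle)).trans
      (range_le_schurSquare hodd hdvd (irreducible_cyclotomic_two hdvd hroot) hC hle hnle)

theorem mainTheorem11 (p m L : ℕ) (hp : p.Prime) (hodd : Odd p) (hm : 1 ≤ m)
    (hroot : IsPrimitiveRootModulo 2 (p ^ m)) (hL : 2 ≤ L)
    (C : ℕ → BinaryLinearCode (p ^ m)) (hC : IsCyclicSquareChain C L) :
    StabilizesAtLevel C L 2 ∧
      ∀ k, 2 ≤ k → k ≤ L → C k = C 2 ∧ schurSquare (C k) = C k := by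
  have h12 : C 2 = schurSquare (C 1) := hC.succ_eq_square 1 le_rfl hL
  have h22 : schurSquare (C 2) = C 2 := by
    rw [h12, schurSquare_schurSquare hp hodd hroot (hC.cyclic 1 le_rfl (by omega))]
  refine ⟨⟨1, rfl, ⟨le_rfl, hL, h12.symm, h22.symm⟩, fun t ht => ht.1⟩, fun k hk => ?_⟩
  induction k, hk using Nat.le_induction with
  | base => exact fun _ => ⟨rfl, h22⟩
  | succ k hk ih =>
    intro hkL
    obtain ⟨hk2, hsq⟩ := ih (by omega)
    have h := hC.succ_eq_square k (by omega) hkL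
    rw [hsq, hk2] at h
    exact ⟨h, by rw [h, h22]⟩
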